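/- Let $\mathcal H$ be a complex Hilbert space, let $N\ge 0$ be an integer, and for $t\in\mathbb S^1=\partial\mathbb D$ let $$\mathcal P(t)=\begin{pmatrix}P(t)&R_-(t)\\ R_+(t)&0\end{pmatrix}:\ \mathcal H\oplus\mathbb C^N\to\mathcal H\oplus\mathbb C^N$$ be bounded operators. Suppose that the loop $t\mapsto\mathcal P(t)$ is contractible in the set of invertible operators, in the sense that it has an extension $z\mapsto\mathcal P(z)$ to the closed unit disc $\overline{\mathbb D}$ which is $C^1$ up to the boundary (in the real sense, for the operator norm) and whose values are bounded invertible operators on $\mathcal H\oplus\mathbb C^N$ (not necessarily with vanishing lower right entry when $|z|<1$). Suppose also that for every direction $v\in\mathbb R^2\cong\mathbb C$ the derivative $z\mapsto d\mathcal P(z)v$ takes values in the trace class operators and is continuous on $\overline{\mathbb D}$ for the trace norm. Write $$\mathcal P(t)^{-1}=\begin{pmatrix}E(t)&E_+(t)\\ E_-(t)&E_{-+}(t)\end{pmatrix},\qquad t\in\mathbb S^1 .$$ If $P(t)$ is invertible for every $t\in\mathbb S^1$, then $t\mapsto P(t)$ and $t\mapsto E_{-+}(t)$ are $C^1$ on $\mathbb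 S^1$, $E_{-+}(t)$ is invertible for every $t\in\mathbb S^1$, the operator $\int_{\mathbb S^1}P^{-1}\,dP$ is of trace class, and $$\operatorname{tr}\int_{\mathbb S^1}P^{-1}\,dP=\operatorname{tr}\int_{\mathbb S^1}E_{-+}^{-1}\,dE_{-+}.$$ Here, for $C^1$ loops $A$, $B$ of bounded operators, $\int_{\mathbb S^1}B\,dA=\int_0^{2\pi}B(e^{i\theta})\,\frac{d}{d\theta}A(e^{i\theta})\,d\theta$. -/

import Mathlib

open scoped InnerProductSpace

noncomputable section

namespace Grushin

section TraceClass

variable {X : Type*} [NormedAddCommGroup X] [InnerProductSpace ℂ X] [CompleteSpace X]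

/-- The vectors of some fixed Hilbert basis (complete orthonormal system) of `X`. -/
def basisSet (X : Type*) [NormedAddCommGroup X] [InnerProductSpace ℂ X] [CompleteSpace X] :
    Set X :=
  (exists_hilbertBasis ℂ X).choose

/-- A fixed Hilbert basis (complete orthonormal system) of `X`. -/
def stdBasis (X : Type*) [NormedAddCommGroup X] [InnerProductSpace ℂ X] [CompleteSpace X] :
    HilbertBasis (basisSet X) ℂ X :=
  (exists_hilbertBasis ℂ X).choose_spec.choose

/-- The trace norm `‖T‖₁ = ∑ᵢ ⟨|T| eᵢ, eᵢ⟩ ∈ [0, ∞]`, where `|T| = (T* T)^{1/2}`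
(`CFC.abs`, through the continuous functional calculus) and `(eᵢ)` is a Hilbert basis.
It is the sum of the singular values of `T`, and it does not depend on the basis. -/
def traceNorm (T : X →L[ℂ] X) : ENNReal :=
  ∑' i, ENNReal.ofReal (RCLike.re ⟪stdBasis X i, CFC.abs T (stdBasis X i)⟫_ℂ)

/-- `T` is of trace class: `tr |T| < ∞`. -/
def IsTraceClass (T : X →L[ℂ] X) : Prop :=
  traceNorm T < ⊤

/-- The trace `tr T = ∑ᵢ ⟨T eᵢ, eᵢ⟩` (Mathlib's inner product is linear in the second slot);
meaningful when `T` is of trace class. -/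
def opTrace (T : X →L[ℂ] X) : ℂ :=
  ∑' i, ⟪stdBasis X i, T (stdBasis X i)⟫_ℂ

/-- `G` is continuous on `s` as a map into the Banach space of trace class operators with
the trace norm. -/
def TraceClassContinuousOn {Z : Type*} [TopologicalSpace Z] (G : Z → X →L[ℂ] X) (s : Set Z) :
    Prop :=
  (∀ z ∈ s, IsTraceClass (G z)) ∧
    ∀ z ∈ s, Filter.Tendsto (fun w => traceNorm (G w - G z)) (nhdsWithin z s) (nhds 0)

end TraceClass

section Loops

variable {X : Type*} [NormedAddCommGroup X] [InnerProductSpace ℂ X]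

/-- `A` is a `C¹` closed curve of bounded operators. -/
def IsC1Loop (A : Circle → X →L[ℂ] X) : Prop :=
  ContDiff ℝ 1 (fun θ : ℝ => A (Circle.exp θ))

/-- `∫_{𝕊¹} B dA = ∫₀^{2π} B(e^{iθ}) (d/dθ A(e^{iθ})) dθ`, a bounded operator
(Bochner integral in the operator norm). -/
def loopIntegral (B A : Circle → X →L[ℂ] X) : X →L[ℂ] X :=
  ∫ θ in (0 : ℝ)..(2 * Real.pi),
    B (Circle.exp θ) * deriv (fun s : ℝ => A (Circle.exp s)) θ

/-- The closed unit disc. -/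
def disc : Set ℂ := Metric.closedBall 0 1

/-- `F` is a `C¹` extension (in the real sense, up to the boundary) of the closed curve `A` to
the unit disc, with values in `V`. The curve `A` is contractible in `V` if there is such
an `F`. -/
structure IsContraction (V : Set (X →L[ℂ] X)) (A : Circle → X →L[ℂ] X)
    (F : ℂ → X →L[ℂ] X) : Prop where
  contDiffOn : ContDiffOn ℝ 1 F disc
  mapsTo : ∀ z ∈ disc, F z ∈ V
  boundary : ∀ t : Circle, F (t : ℂ) = A t

end Loops

section Blocks

variable {H : Type*} [NormedAddCommGroup H] [InnerProductSpace ℂ H] {N : ℕ}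

/-- The Hilbert space direct sum `H ⊕ ℂ^N`. -/
abbrev Sum2 (H : Type*) [NormedAddCommGroup H] [InnerProductSpace ℂ H] (N : ℕ) : Type _ :=
  WithLp 2 (H × EuclideanSpace ℂ (Fin N))

/-- The Grushin operator `(u, u₋) ↦ (P u + R₋ u₋, R₊ u)` on `H ⊕ ℂ^N`. -/
def grushin (P : H →L[ℂ] H) (Rm : EuclideanSpace ℂ (Fin N) →L[ℂ] H)
    (Rp : H →L[ℂ] EuclideanSpace ℂ (Fin N)) : Sum2 H N →L[ℂ] Sum2 H N :=
  ((WithLp.prodContinuousLinearEquiv 2 ℂ H (EuclideanSpace ℂ (Fin N))).symm :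
      H × EuclideanSpace ℂ (Fin N) →L[ℂ] Sum2 H N) ∘L
    ((P.coprod Rm).prod (Rp.coprod 0)) ∘L
    ((WithLp.prodContinuousLinearEquiv 2 ℂ H (EuclideanSpace ℂ (Fin N))) :
      Sum2 H N →L[ℂ] H × EuclideanSpace ℂ (Fin N))

/-- The effective Hamiltonian `E₋₊ : ℂ^N → ℂ^N`: the lower right entry of the inverse
`((E, E₊), (E₋, E₋₊))` of an (invertible) operator on `H ⊕ ℂ^N`. -/
def effHam (Q : Sum2 H N →L[ℂ] Sum2 H N) :
    EuclideanSpace ℂ (Fin N) →L[ℂ] EuclideanSpace ℂ (Fin N) :=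
  ContinuousLinearMap.snd ℂ H (EuclideanSpace ℂ (Fin N)) ∘L
    ((WithLp.prodContinuousLinearEquiv 2 ℂ H (EuclideanSpace ℂ (Fin N))) :
      Sum2 H N →L[ℂ] H × EuclideanSpace ℂ (Fin N)) ∘L
    Ring.inverse Q ∘L
    ((WithLp.prodContinuousLinearEquiv 2 ℂ H (EuclideanSpace ℂ (Fin N))).symm :
      H × EuclideanSpace ℂ (Fin N) →L[ℂ] Sum2 H N) ∘L
    ContinuousLinearMap.inr ℂ H (EuclideanSpace ℂ (Fin N))

end Blocks

end Grushin

end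

/-! Write `i`, `p`, `j`, `q` for the inclusions and projections of `H` and `ℂ^N`, so that P = pFi
and E = qF⁻¹j on the circle. The Schur complement identity reads F⁻¹ = i P⁻¹ p + F⁻¹j E⁻¹ qF⁻¹.
Pairing it with dF, using cyclicity of the trace and dE = -qF⁻¹ dF F⁻¹j, gives tr F⁻¹dF = tr P⁻¹dP -
tr E⁻¹dE. It remains to see that tr F⁻¹dF integrates to 0 over the circle
(`integral_tracePairing_circle_eq_zero`).

The form tr M⁻¹dM is closed, by cyclicity (`tracePairing_mul_mul_comm`), but F is only C¹, so
Stokes' theorem is not applied to F directly. Instead, nearby concentric circles are joined by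
straight segments in the space of operators, where the mixed derivative exists
(`integral_tracePairing_eq_of_segment`). The integral over the circle of radius r is thus locally
constant in r, and it is 0 for r = 0.

The analysis takes place in the Banach space `TraceClass`. Its properties rest on two descriptions
of the trace norm: absolutely convergent sums of rank one operators
(`IsTraceClass.exists_nuclearRep`), which give cyclicity, and duality with finite rank operators
(`RankBound.norm_sum_inner_le`, `traceNorm_le_of_forall`), which gives the norm axioms, the ideal
property and completeness. -/

namespace Grushin

/-! ### Polar decomposition. -/

section Polar

variable {X : Type*} [NormedAddCommGroup X] [InnerProductSpace ℂ X] [CompleteSpace X]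

open ContinuousLinearMap in
theorem norm_abs_apply (T : X →L[ℂ] X) (x : X) : ‖CFC.abs T x‖ = ‖T x‖ := by
  have hsa : adjoint (CFC.abs T) = CFC.abs T := (CFC.abs_nonneg T).isSelfAdjoint.star_eq
  have h : adjoint (CFC.abs T) (CFC.abs T x) = adjoint T (T x) := by
    rw [hsa]
    exact congrArg (fun S : X →L[ℂ] X => S x) (CFC.abs_mul_abs T)
  have h2 : ‖CFC.abs T x‖ ^ 2 = ‖T x‖ ^ 2 := by
    have h3 : ⟪CFC.abs T x, CFC.abs T x⟫_ℂ = ⟪T x, T x⟫_ℂ := by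
      rw [← adjoint_inner_right, h, adjoint_inner_right]
    rw [inner_self_eq_norm_sq_to_K, inner_self_eq_norm_sq_to_K] at h3
    exact_mod_cast h3
  exact (sq_eq_sq₀ (norm_nonneg _) (norm_nonneg _)).1 h2

/-- Polar decomposition, with a contraction in place of a partial isometry. -/
theorem exists_polar (T : X →L[ℂ] X) :
    ∃ U : X →L[ℂ] X, ‖U‖ ≤ 1 ∧ ∀ x, U (CFC.abs T x) = T x := by
  set S := CFC.abs T
  -- Since ‖Tx‖ = ‖|T|x‖, the map |T|x ↦ Tx is well defined and isometric on the range of |T|. It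
  -- extends to the closure `K`, and precomposing with the projection onto `K` gives `U`.
  let K : Submodule ℂ X := S.range.topologicalClosure
  have : CompleteSpace K := S.range.isClosed_topologicalClosure.completeSpace_coe
  let e : X →ₗ[ℂ] K := (S : X →ₗ[ℂ] X).codRestrict K
    fun x => Submodule.le_topologicalClosure _ ⟨x, rfl⟩
  have he : DenseRange e := by
    intro y
    rw [Metric.mem_closure_iff]
    intro ε hε
    have hy : (y : X) ∈ closure (S.range : Set X) := y.2
    obtain ⟨_, ⟨x, rfl⟩, hx⟩ := Metric.mem_closure_iff.1 hy ε hε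
    exact ⟨e x, ⟨x, rfl⟩, hx⟩
  have hn : ∀ x, ‖(T : X →ₗ[ℂ] X) x‖ ≤ 1 * ‖e x‖ := by
    intro x
    rw [one_mul]
    exact (norm_abs_apply T x).ge
  refine ⟨(LinearMap.extendOfNorm (T : X →ₗ[ℂ] X) e) ∘L K.orthogonalProjectionOnto, ?_, fun x => ?_⟩
  · refine (ContinuousLinearMap.opNorm_comp_le _ _).trans ?_
    exact mul_le_one₀ (LinearMap.opNorm_extendOfNorm_le he zero_le_one hn) (norm_nonneg _)
      K.orthogonalProjectionOnto_norm_le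
  · have h1 : K.orthogonalProjectionOnto (S x) = e x :=
      K.orthogonalProjectionOnto_mem_subspace_eq_self (e x)
    rw [ContinuousLinearMap.comp_apply, h1, LinearMap.extendOfNorm_eq he ⟨1, hn⟩]
    rfl

-- Expanding, ‖U*Uw - w‖² = ‖U*Uw‖² - 2‖Uw‖² + ‖w‖² ≤ 0. For the polar factor this yields U*T = |T|
-- although `U` is only known to be a contraction.
open ContinuousLinearMap in
theorem adjoint_apply_apply_of_norm_eq {U : X →L[ℂ] X} (hU : ‖U‖ ≤ 1) {w : X}
    (hw : ‖U w‖ = ‖w‖) : adjoint U (U w) = w := by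
  have h1 : ‖adjoint U (U w)‖ ≤ ‖w‖ := by
    rw [← hw]
    refine (le_opNorm _ _).trans ?_
    rw [LinearIsometryEquiv.norm_map]
    exact mul_le_of_le_one_left (norm_nonneg _) hU
  have h2 : RCLike.re ⟪adjoint U (U w), w⟫_ℂ = ‖w‖ ^ 2 := by
    rw [adjoint_inner_left, inner_self_eq_norm_sq, hw]
  have h3 := norm_sub_sq (𝕜 := ℂ) (adjoint U (U w)) w
  rw [h2] at h3
  have h4 : ‖adjoint U (U w) - w‖ ^ 2 ≤ 0 := by
    nlinarith [norm_nonneg (adjoint U (U w)), norm_nonneg w]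
  have h5 : ‖adjoint U (U w) - w‖ = 0 := by
    exact pow_eq_zero_iff two_ne_zero |>.1 (le_antisymm h4 (sq_nonneg _))
  exact sub_eq_zero.1 (norm_eq_zero.1 h5)

end Polar

/-! ### Nuclear representations and duality for the trace norm. -/

section Nuclear

theorem norm_sum_smul_sq {X ι : Type*} [NormedAddCommGroup X] [InnerProductSpace ℂ X] [Fintype ι]
    {v : ι → X} (hv : Orthonormal ℂ v) (l : ι → ℂ) :
    ‖∑ i, l i • v i‖ ^ 2 = ∑ i, ‖l i‖ ^ 2 := by
  rw [← inner_self_eq_norm_sq (𝕜 := ℂ), hv.inner_sum, map_sum]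
  refine Finset.sum_congr rfl fun i _ => ?_
  rw [RCLike.conj_mul]
  exact_mod_cast RCLike.ofReal_re (K := ℂ) _

variable {X : Type*} [NormedAddCommGroup X] [InnerProductSpace ℂ X] [CompleteSpace X]

/-- `T = ∑ⱼ uⱼ ⊗ vⱼ*` (weakly) with `∑ⱼ ‖uⱼ‖ ‖vⱼ‖ < ∞`. -/
structure IsNuclearRep {J : Type*} (T : X →L[ℂ] X) (u v : J → X) : Prop where
  summable : Summable fun j => ‖u j‖ * ‖v j‖
  hasSum : ∀ x y, HasSum (fun j => ⟪y, u j⟫_ℂ * ⟪v j, x⟫_ℂ) ⟪y, T x⟫_ℂ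

theorem inner_abs_eq_norm_sq (T : X →L[ℂ] X) (x : X) :
    RCLike.re ⟪x, CFC.abs T x⟫_ℂ = ‖CFC.sqrt (CFC.abs T) x‖ ^ 2 := by
  have hsa : ContinuousLinearMap.adjoint (CFC.sqrt (CFC.abs T)) = CFC.sqrt (CFC.abs T) :=
    (CFC.sqrt_nonneg (CFC.abs T)).isSelfAdjoint.star_eq
  have h : CFC.abs T x = CFC.sqrt (CFC.abs T) (CFC.sqrt (CFC.abs T) x) :=
    (congrArg (fun S : X →L[ℂ] X => S x)
      (CFC.sqrt_mul_sqrt_self (CFC.abs T) (CFC.abs_nonneg T))).symm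
  rw [h, ← ContinuousLinearMap.adjoint_inner_left, hsa, inner_self_eq_norm_sq]

/-- With S = |T|^{1/2} one has T = U S S. Inserting the basis between the two factors gives uⱼ = U S
eⱼ and vⱼ = S eⱼ, and the sum of ‖S eⱼ‖² is the trace norm. -/
theorem IsTraceClass.exists_nuclearRep {T : X →L[ℂ] X} (hT : IsTraceClass T) :
    ∃ u v : basisSet X → X, IsNuclearRep T u v ∧
      ∑' j, ‖u j‖ * ‖v j‖ ≤ (traceNorm T).toReal := by
  obtain ⟨U, hU, hUT⟩ := exists_polar T
  set S := CFC.sqrt (CFC.abs T)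
  have hsa : ContinuousLinearMap.adjoint S = S :=
    (CFC.sqrt_nonneg (CFC.abs T)).isSelfAdjoint.star_eq
  have hSS : ∀ x, S (S x) = CFC.abs T x := fun x => congrArg (fun S : X →L[ℂ] X => S x)
      (CFC.sqrt_mul_sqrt_self (CFC.abs T) (CFC.abs_nonneg T))
  have hfin : ∑' j, ENNReal.ofReal (‖S (stdBasis X j)‖ ^ 2) = traceNorm T := by
    simp only [traceNorm, inner_abs_eq_norm_sq, S]
  have hsum : Summable fun j => ‖S (stdBasis X j)‖ ^ 2 := by
    have := ENNReal.summable_toReal (hfin.trans_lt hT).ne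
    refine this.congr fun j => ?_
    rw [ENNReal.toReal_ofReal (sq_nonneg _)]
  have hle : ∀ j, ‖U (S (stdBasis X j))‖ * ‖S (stdBasis X j)‖ ≤ ‖S (stdBasis X j)‖ ^ 2 := by
    intro j
    rw [sq]
    gcongr
    exact (U.le_opNorm _).trans (mul_le_of_le_one_left (norm_nonneg _) hU)
  have hsum' := hsum.of_nonneg_of_le (fun j => by positivity) hle
  refine ⟨fun j => U (S (stdBasis X j)), fun j => S (stdBasis X j), ⟨hsum', ?_⟩, ?_⟩
  · intro x y
    have h := (stdBasis X).hasSum_inner_mul_inner (S (ContinuousLinearMap.adjoint U y)) (S x)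
    have hsym : ∀ x y, ⟪S x, y⟫_ℂ = ⟪x, S y⟫_ℂ := fun x y => by
      rw [← ContinuousLinearMap.adjoint_inner_left S, hsa]
    simp only [hsym, hSS, ContinuousLinearMap.adjoint_inner_left, hUT] at h
    simpa only [hsym] using h
  · refine (hsum'.tsum_le_tsum hle hsum).trans_eq ?_
    rw [← hfin, ENNReal.tsum_toReal_eq (fun j => ENNReal.ofReal_ne_top)]
    exact tsum_congr fun j => (ENNReal.toReal_ofReal (sq_nonneg _)).symm

/-- The finite rank operator `∑ᵢ xᵢ ⊗ yᵢ*` has norm at most `c`. -/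
def RankBound {ι : Type*} [Fintype ι] (x y : ι → X) (c : ℝ) : Prop :=
  ∀ z, ‖∑ i, ⟪y i, z⟫_ℂ • x i‖ ≤ c * ‖z‖

-- For K = ∑ᵢ xᵢ ⊗ yᵢ* the sum on the left is tr(TK), and each rank one piece of T contributes ⟨vⱼ,
-- K uⱼ⟩, at most c‖uⱼ‖‖vⱼ‖ in absolute value.
omit [CompleteSpace X] in
theorem IsNuclearRep.norm_sum_inner_le {J ι : Type*} [Fintype ι] {T : X →L[ℂ] X} {u v : J → X}
    (h : IsNuclearRep T u v) {x y : ι → X} {c : ℝ} (hxy : RankBound x y c) :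
    ‖∑ i, ⟪y i, T (x i)⟫_ℂ‖ ≤ c * ∑' j, ‖u j‖ * ‖v j‖ := by
  have h1 : HasSum (fun j => ∑ i, ⟪y i, u j⟫_ℂ * ⟪v j, x i⟫_ℂ) (∑ i, ⟪y i, T (x i)⟫_ℂ) :=
    hasSum_sum fun i _ => h.hasSum (x i) (y i)
  have h2 : ∀ j, ‖∑ i, ⟪y i, u j⟫_ℂ * ⟪v j, x i⟫_ℂ‖ ≤ c * (‖u j‖ * ‖v j‖) := by
    intro j
    have : ∑ i, ⟪y i, u j⟫_ℂ * ⟪v j, x i⟫_ℂ = ⟪v j, ∑ i, ⟪y i, u j⟫_ℂ • x i⟫_ℂ := by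
      simp
    rw [this]
    refine (norm_inner_le_norm _ _).trans ?_
    calc ‖v j‖ * ‖∑ i, ⟪y i, u j⟫_ℂ • x i‖ ≤ ‖v j‖ * (c * ‖u j‖) := by gcongr; exact hxy _
      _ = _ := by ring
  rw [← tsum_mul_left, ← h1.tsum_eq]
  exact tsum_of_norm_bounded (h.summable.mul_left c).hasSum h2

theorem RankBound.norm_sum_inner_le {ι : Type*} [Fintype ι] {T : X →L[ℂ] X}
    (hT : IsTraceClass T) {x y : ι → X} {c : ℝ} (hc : 0 ≤ c) (hxy : RankBound x y c) :
    ‖∑ i, ⟪y i, T (x i)⟫_ℂ‖ ≤ c * (traceNorm T).toReal := by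
  obtain ⟨u, v, h, hle⟩ := hT.exists_nuclearRep
  exact (h.norm_sum_inner_le hxy).trans (by gcongr)

/-- Testing against K = ∑ eₖ ⊗ (U eₖ)*, over finitely many basis vectors, recovers the partial sums
of ∑ ⟨eₖ, |T| eₖ⟩, because U*T = |T|. With `RankBound.norm_sum_inner_le` this makes the trace norm a
supremum over finite rank contractions. -/
theorem traceNorm_le_of_forall {T : X →L[ℂ] X} {c : ℝ}
    (h : ∀ (n : ℕ) (x y : Fin n → X), RankBound x y 1 → ‖∑ i, ⟪y i, T (x i)⟫_ℂ‖ ≤ c) :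
    traceNorm T ≤ ENNReal.ofReal c := by
  obtain ⟨U, hU, hUT⟩ := exists_polar T
  have hab : ∀ x, ContinuousLinearMap.adjoint U (T x) = CFC.abs T x := fun x => by
    rw [← hUT]
    exact adjoint_apply_apply_of_norm_eq hU (by rw [hUT, norm_abs_apply])
  rw [traceNorm, ENNReal.tsum_eq_iSup_sum]
  refine iSup_le fun s => ?_
  rw [← ENNReal.ofReal_sum_of_nonneg
    (fun i _ => by rw [inner_abs_eq_norm_sq]; positivity)]
  refine ENNReal.ofReal_le_ofReal ?_
  let e := s.equivFin.symm
  have ho : Orthonormal ℂ fun k => stdBasis X (e k) :=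
    (stdBasis X).orthonormal.comp _ (Subtype.val_injective.comp e.injective)
  -- K is U* followed by an orthogonal projection; Bessel's inequality bounds it.
  have hb : RankBound (fun k => stdBasis X (e k)) (fun k => U (stdBasis X (e k))) 1 := by
    intro z
    have h1 : ‖∑ k, ⟪U (stdBasis X (e k)), z⟫_ℂ • stdBasis X (e k)‖ ^ 2 ≤
        ‖ContinuousLinearMap.adjoint U z‖ ^ 2 := by
      rw [norm_sum_smul_sq ho]
      refine le_trans (Finset.sum_le_sum fun k _ => ?_)
        (ho.sum_inner_products_le (x := ContinuousLinearMap.adjoint U z) (s := Finset.univ))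
      rw [ContinuousLinearMap.adjoint_inner_right]
    have h2 := (sq_le_sq₀ (norm_nonneg _) (norm_nonneg _)).1 h1
    refine h2.trans ((ContinuousLinearMap.le_opNorm _ _).trans ?_)
    rw [LinearIsometryEquiv.norm_map]
    gcongr
  have h1 := h _ _ _ hb
  have h2 : ∑ i ∈ s, RCLike.re ⟪stdBasis X i, CFC.abs T (stdBasis X i)⟫_ℂ =
      RCLike.re (∑ k, ⟪U (stdBasis X (e k)), T (stdBasis X (e k))⟫_ℂ) := by
    rw [← Finset.sum_coe_sort s, ← e.sum_comp, map_sum]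
    refine Finset.sum_congr rfl fun k _ => ?_
    rw [← hab, ContinuousLinearMap.adjoint_inner_right]
  rw [h2]
  exact (RCLike.re_le_norm _).trans h1

theorem isTraceClass_of_forall {T : X →L[ℂ] X} {c : ℝ}
    (h : ∀ (n : ℕ) (x y : Fin n → X), RankBound x y 1 → ‖∑ i, ⟪y i, T (x i)⟫_ℂ‖ ≤ c) :
    IsTraceClass T :=
  (traceNorm_le_of_forall h).trans_lt ENNReal.ofReal_lt_top

theorem toReal_traceNorm_le_of_forall {T : X →L[ℂ] X} {c : ℝ} (hc : 0 ≤ c)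
    (h : ∀ (n : ℕ) (x y : Fin n → X), RankBound x y 1 → ‖∑ i, ⟪y i, T (x i)⟫_ℂ‖ ≤ c) :
    (traceNorm T).toReal ≤ c :=
  ENNReal.toReal_le_of_le_ofReal hc (traceNorm_le_of_forall h)

end Nuclear
end Grushin

namespace Grushin

/-! ### The trace, its cyclicity, and the ideal of trace class operators. -/

section Trace

variable {X : Type*} [NormedAddCommGroup X] [InnerProductSpace ℂ X] [CompleteSpace X]
variable {Y : Type*} [NormedAddCommGroup Y] [InnerProductSpace ℂ Y] [CompleteSpace Y]

omit [CompleteSpace X] in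
theorem tsum_norm_inner_mul_inner_le {ι : Type*} (b : HilbertBasis ι ℂ X) (x y : X) :
    (Summable fun i => ‖⟪x, b i⟫_ℂ * ⟪b i, y⟫_ℂ‖) ∧
      ∑' i, ‖⟪x, b i⟫_ℂ * ⟪b i, y⟫_ℂ‖ ≤ ‖x‖ * ‖y‖ := by
  have key : ∀ s : Finset ι, ∑ i ∈ s, ‖⟪x, b i⟫_ℂ * ⟪b i, y⟫_ℂ‖ ≤ ‖x‖ * ‖y‖ := by
    intro s
    have h1 := Finset.sum_mul_sq_le_sq_mul_sq s (fun i => ‖⟪b i, x⟫_ℂ‖) (fun i => ‖⟪b i, y⟫_ℂ‖)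
    have h2 := b.orthonormal.sum_inner_products_le (x := x) (s := s)
    have h3 := b.orthonormal.sum_inner_products_le (x := y) (s := s)
    have h4 : ∑ i ∈ s, ‖⟪x, b i⟫_ℂ * ⟪b i, y⟫_ℂ‖ = ∑ i ∈ s, ‖⟪b i, x⟫_ℂ‖ * ‖⟪b i, y⟫_ℂ‖ :=
      Finset.sum_congr rfl fun i _ => by rw [norm_mul, norm_inner_symm]
    rw [h4]
    refine (sq_le_sq₀ (by positivity) (by positivity)).1 (h1.trans ?_)
    rw [mul_pow]
    gcongr
  have hs := summable_of_sum_le (fun i => norm_nonneg _) key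
  exact ⟨hs, hs.tsum_le_of_sum_le key⟩

theorem IsNuclearRep.summable_trace {J : Type*} {T : X →L[ℂ] X} {u v : J → X}
    (h : IsNuclearRep T u v) :
    Summable fun p : J × basisSet X => ‖⟪v p.1, stdBasis X p.2⟫_ℂ * ⟪stdBasis X p.2, u p.1⟫_ℂ‖ := by
  rw [summable_prod_of_nonneg fun p => norm_nonneg _]
  refine ⟨fun j => (tsum_norm_inner_mul_inner_le (stdBasis X) (v j) (u j)).1,
    h.summable.of_nonneg_of_le (fun j => tsum_nonneg fun _ => norm_nonneg _) fun j => ?_⟩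
  rw [mul_comm]
  exact (tsum_norm_inner_mul_inner_le (stdBasis X) (v j) (u j)).2

/-- The double series over j and the basis converges absolutely, so it may be summed in either
order. The value no longer mentions the basis, which is what allows traces on different spaces to be
compared. -/
theorem IsNuclearRep.hasSum_trace {J : Type*} {T : X →L[ℂ] X} {u v : J → X}
    (h : IsNuclearRep T u v) :
    HasSum (fun i => ⟪stdBasis X i, T (stdBasis X i)⟫_ℂ) (∑' j, ⟪v j, u j⟫_ℂ) := by
  have hs := h.summable_trace.of_norm
  have h1 : ∑' p : J × basisSet X, ⟪v p.1, stdBasis X p.2⟫_ℂ * ⟪stdBasis X p.2, u p.1⟫_ℂ =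
      ∑' j, ⟪v j, u j⟫_ℂ := by
    rw [hs.tsum_prod]
    exact tsum_congr fun j => ((stdBasis X).hasSum_inner_mul_inner (v j) (u j)).tsum_eq
  have h2 := ((Equiv.prodComm (basisSet X) J).hasSum_iff.2 hs.hasSum).prod_fiberwise
    (g := fun i => ⟪stdBasis X i, T (stdBasis X i)⟫_ℂ) fun i => by
      simpa [mul_comm] using h.hasSum (stdBasis X i) (stdBasis X i)
  rwa [h1] at h2

theorem IsTraceClass.summable_trace {T : X →L[ℂ] X} (hT : IsTraceClass T) :
    Summable fun i => ⟪stdBasis X i, T (stdBasis X i)⟫_ℂ := by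
  obtain ⟨u, v, h, -⟩ := hT.exists_nuclearRep
  exact h.hasSum_trace.summable

theorem IsTraceClass.norm_opTrace_le {T : X →L[ℂ] X} (hT : IsTraceClass T) :
    ‖opTrace T‖ ≤ (traceNorm T).toReal := by
  obtain ⟨u, v, h, hle⟩ := hT.exists_nuclearRep
  rw [opTrace, h.hasSum_trace.tsum_eq]
  refine (tsum_of_norm_bounded h.summable.hasSum fun j => ?_).trans hle
  rw [mul_comm]
  exact norm_inner_le_norm _ _

open ContinuousLinearMap in
theorem IsNuclearRep.sandwich {J : Type*} {T : X →L[ℂ] X} {u v : J → X}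
    (h : IsNuclearRep T u v) (V : X →L[ℂ] Y) (W : Y →L[ℂ] X) :
    IsNuclearRep (V ∘L T ∘L W) (fun j => V (u j)) (fun j => adjoint W (v j)) where
  summable := by
    refine (h.summable.mul_left (‖V‖ * ‖adjoint W‖)).of_nonneg_of_le (fun j => by positivity)
      fun j => ?_
    calc ‖V (u j)‖ * ‖adjoint W (v j)‖ ≤ (‖V‖ * ‖u j‖) * (‖adjoint W‖ * ‖v j‖) := by
          gcongr <;> exact le_opNorm _ _
      _ = _ := by ring
  hasSum x y := by
    have := h.hasSum (W x) (adjoint V y)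
    simp only [adjoint_inner_left] at this
    simpa only [adjoint_inner_left, comp_apply] using this

theorem RankBound.sandwich {ι : Type*} [Fintype ι] {x y : ι → Y} {c : ℝ} (hc : 0 ≤ c)
    (h : RankBound x y c)    (V : X →L[ℂ] Y) (W : Y →L[ℂ] X) :
    RankBound (fun i => W (x i)) (fun i => ContinuousLinearMap.adjoint V (y i))
      (‖W‖ * c * ‖V‖) := by
  intro z
  have h1 : ∑ i, ⟪ContinuousLinearMap.adjoint V (y i), z⟫_ℂ • W (x i) =
      W (∑ i, ⟪y i, V z⟫_ℂ • x i) := by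
    simp [ContinuousLinearMap.adjoint_inner_left]
  rw [h1]
  calc ‖W (∑ i, ⟪y i, V z⟫_ℂ • x i)‖ ≤ ‖W‖ * (c * (‖V‖ * ‖z‖)) := by
        refine (W.le_opNorm _).trans ?_
        gcongr
        exact (h (V z)).trans (by gcongr; exact V.le_opNorm z)
    _ = _ := by ring

theorem IsTraceClass.sandwich_bound {T : X →L[ℂ] X} (hT : IsTraceClass T) (V : X →L[ℂ] Y)
    (W : Y →L[ℂ] X) (n : ℕ) (x y : Fin n → Y) (h : RankBound x y 1) :
    ‖∑ i, ⟪y i, (V ∘L T ∘L W) (x i)⟫_ℂ‖ ≤ ‖W‖ * 1 * ‖V‖ * (traceNorm T).toReal := by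
  have := (h.sandwich zero_le_one V W).norm_sum_inner_le hT (by positivity)
  simpa only [ContinuousLinearMap.adjoint_inner_left, ContinuousLinearMap.comp_apply] using this

theorem IsTraceClass.sandwich {T : X →L[ℂ] X} (hT : IsTraceClass T) (V : X →L[ℂ] Y)
    (W : Y →L[ℂ] X) : IsTraceClass (V ∘L T ∘L W) :=
  isTraceClass_of_forall (hT.sandwich_bound V W)

theorem IsTraceClass.traceNorm_sandwich_le {T : X →L[ℂ] X} (hT : IsTraceClass T)
    (V : X →L[ℂ] Y) (W : Y →L[ℂ] X) :
    (traceNorm (V ∘L T ∘L W)).toReal ≤ ‖V‖ * ‖W‖ * (traceNorm T).toReal := by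
  refine (toReal_traceNorm_le_of_forall (by positivity) (hT.sandwich_bound V W)).trans_eq ?_
  ring

/-- Cyclicity, also between two different spaces: a nuclear representation of T induces one of each
side, and both traces become ∑ⱼ ⟨vⱼ, W V uⱼ⟩. -/
theorem IsTraceClass.opTrace_sandwich {T : X →L[ℂ] X} (hT : IsTraceClass T)
    (V : X →L[ℂ] Y) (W : Y →L[ℂ] X) :
    opTrace (V ∘L T ∘L W) = opTrace ((W ∘L V) ∘L T) := by
  obtain ⟨u, v, h, -⟩ := hT.exists_nuclearRep
  have h2 := h.sandwich (W ∘L V) (ContinuousLinearMap.id ℂ X)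
  rw [ContinuousLinearMap.comp_id] at h2
  rw [opTrace, opTrace, (h.sandwich V W).hasSum_trace.tsum_eq, h2.hasSum_trace.tsum_eq]
  simp [ContinuousLinearMap.adjoint_inner_left]

theorem IsTraceClass.add {S T : X →L[ℂ] X} (hS : IsTraceClass S) (hT : IsTraceClass T) :
    IsTraceClass (S + T) ∧
      (traceNorm (S + T)).toReal ≤ (traceNorm S).toReal + (traceNorm T).toReal := by
  have key : ∀ (n : ℕ) (x y : Fin n → X), RankBound x y 1 →
      ‖∑ i, ⟪y i, (S + T) (x i)⟫_ℂ‖ ≤ (traceNorm S).toReal + (traceNorm T).toReal := by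
    intro n x y h
    have h1 := h.norm_sum_inner_le hS zero_le_one
    have h2 := h.norm_sum_inner_le hT zero_le_one
    rw [one_mul] at h1 h2
    simp only [add_apply, inner_add_right, Finset.sum_add_distrib]
    exact norm_add_le_of_le h1 h2
  exact ⟨isTraceClass_of_forall key,
    toReal_traceNorm_le_of_forall (add_nonneg ENNReal.toReal_nonneg ENNReal.toReal_nonneg) key⟩

theorem IsTraceClass.smul {T : X →L[ℂ] X} (hT : IsTraceClass T) (c : ℂ) :
    IsTraceClass (c • T) ∧
      (traceNorm (c • T)).toReal ≤ ‖c‖ * (traceNorm T).toReal := by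
  have key : ∀ (n : ℕ) (x y : Fin n → X), RankBound x y 1 →
      ‖∑ i, ⟪y i, (c • T) (x i)⟫_ℂ‖ ≤ ‖c‖ * (traceNorm T).toReal := by
    intro n x y h
    have h1 := h.norm_sum_inner_le hT zero_le_one
    rw [one_mul] at h1
    simp only [smul_apply, inner_smul_right, ← Finset.mul_sum, norm_mul]
    gcongr
  exact ⟨isTraceClass_of_forall key,
    toReal_traceNorm_le_of_forall (mul_nonneg (norm_nonneg _) ENNReal.toReal_nonneg) key⟩

theorem traceNorm_zero : traceNorm (0 : X →L[ℂ] X) = 0 := by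
  simp [traceNorm]

/-- Duality is tested on the rank one operator x ⊗ (Tx)*. -/
theorem IsTraceClass.norm_le {T : X →L[ℂ] X} (hT : IsTraceClass T) :
    ‖T‖ ≤ (traceNorm T).toReal := by
  have key : ∀ x y : X, ‖⟪y, T x⟫_ℂ‖ ≤ ‖x‖ * ‖y‖ * (traceNorm T).toReal := by
    intro x y
    have hb : RankBound (fun _ : Fin 1 => x) (fun _ => y) (‖x‖ * ‖y‖) := by
      intro z
      rw [Fin.sum_univ_one, norm_smul]
      calc ‖⟪y, z⟫_ℂ‖ * ‖x‖ ≤ (‖y‖ * ‖z‖) * ‖x‖ := by gcongr; exact norm_inner_le_norm _ _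
        _ = _ := by ring
    simpa using hb.norm_sum_inner_le hT (by positivity)
  refine ContinuousLinearMap.opNorm_le_bound _ ENNReal.toReal_nonneg fun x => ?_
  have h := key x (T x)
  rw [inner_self_eq_norm_sq_to_K, norm_pow, RCLike.norm_ofReal, abs_norm] at h
  rcases (norm_nonneg (T x)).eq_or_lt with h0 | h0
  · rw [← h0]
    exact mul_nonneg ENNReal.toReal_nonneg (norm_nonneg _)
  · refine le_of_mul_le_mul_right ?_ h0
    linarith

end Trace

/-! ### The Banach space of trace class operators. -/

section Space

/-- The subspace of trace class operators. -/
def traceClassSubmodule (X : Type*) [NormedAddCommGroup X] [InnerProductSpace ℂ X]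
    [CompleteSpace X] : Submodule ℂ (X →L[ℂ] X) where
  carrier := {T | IsTraceClass T}
  add_mem' hS hT := (hS.add hT).1
  zero_mem' := by simp [IsTraceClass, traceNorm_zero]
  smul_mem' c _ hT := (hT.smul c).1

/-- The Banach space of trace class operators, normed by the trace norm. -/
def TraceClass (X : Type*) [NormedAddCommGroup X] [InnerProductSpace ℂ X]
    [CompleteSpace X] : Type _ :=
  traceClassSubmodule X

namespace TraceClass

variable {X : Type*} [NormedAddCommGroup X] [InnerProductSpace ℂ X] [CompleteSpace X]
variable {Y : Type*} [NormedAddCommGroup Y] [InnerProductSpace ℂ Y] [CompleteSpace Y]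

/-- Only the algebraic structure is taken from the submodule, whose own norm would be the operator
norm. -/
noncomputable instance : AddCommGroup (TraceClass X) :=
  inferInstanceAs (AddCommGroup (traceClassSubmodule X))

noncomputable instance : Module ℂ (TraceClass X) :=
  inferInstanceAs (Module ℂ (traceClassSubmodule X))

/-- The underlying operator, as a linear map. -/
def toOpₗ : TraceClass X →ₗ[ℂ] X →L[ℂ] X :=
  (traceClassSubmodule X).subtype

theorem toOpₗ_injective : Function.Injective (toOpₗ (X := X)) :=
  Subtype.val_injective

theorem isTraceClass (T : TraceClass X) : IsTraceClass (toOpₗ T) := T.2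

/-- A trace class operator as an element of the Banach space. -/
def mk (T : X →L[ℂ] X) (hT : IsTraceClass T) : TraceClass X := ⟨T, hT⟩

noncomputable instance : Norm (TraceClass X) where
  norm T := (traceNorm (toOpₗ T)).toReal

theorem norm_def (T : TraceClass X) : ‖T‖ = (traceNorm (toOpₗ T)).toReal := rfl

theorem norm_toOpₗ_le (T : TraceClass X) : ‖toOpₗ T‖ ≤ ‖T‖ := T.isTraceClass.norm_le

noncomputable instance : NormedAddCommGroup (TraceClass X) :=
  AddGroupNorm.toNormedAddCommGroup
    { toFun := fun T => ‖T‖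
      map_zero' := by simp [norm_def, traceNorm_zero]
      add_le' := fun S T => by
        rw [norm_def, map_add]
        exact (S.isTraceClass.add T.isTraceClass).2
      neg' := fun T => by
        simp [norm_def, traceNorm]
      eq_zero_of_map_eq_zero' := fun T hT => toOpₗ_injective <| by
        rw [map_zero, ← norm_le_zero_iff]
        exact T.norm_toOpₗ_le.trans_eq hT }

noncomputable instance : NormedSpace ℂ (TraceClass X) where
  norm_smul_le c T := by
    rw [norm_def, map_smul]
    exact (T.isTraceClass.smul c).2

/-- The inclusion of the trace class operators into the bounded operators. -/
noncomputable def toOp : TraceClass X →L[ℂ] X →L[ℂ] X :=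
  toOpₗ.mkContinuous 1 fun T => by
    rw [one_mul]
    exact T.norm_toOpₗ_le

theorem toOp_injective : Function.Injective (toOp (X := X)) := toOpₗ_injective

theorem isTraceClass_toOp (T : TraceClass X) : IsTraceClass (toOp T) := T.2

@[simp]
theorem toOp_mk (T : X →L[ℂ] X) (hT : IsTraceClass T) : toOp (mk T hT) = T := rfl

theorem norm_eq (T : TraceClass X) : ‖T‖ = (traceNorm (toOp T)).toReal := rfl

instance : CompleteSpace (TraceClass X) := by
  refine Metric.complete_of_cauchySeq_tendsto fun u hu => ?_
  obtain ⟨T, hT⟩ := cauchySeq_tendsto_of_complete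
    ((toOp (X := X)).uniformContinuous.comp_cauchySeq hu)
  -- `T` is the limit in operator norm. Each finite duality test is continuous for that norm, so the
  -- Cauchy estimate in trace norm survives the limit.
  have key : ∀ ε > 0, ∃ N, ∀ n ≥ N, ∀ (m : ℕ) (x y : Fin m → X), RankBound x y 1 →
      ‖∑ i, ⟪y i, (toOp (u n) - T) (x i)⟫_ℂ‖ ≤ ε := by
    intro ε hε
    obtain ⟨N, hN⟩ := Metric.cauchySeq_iff.1 hu ε hε
    refine ⟨N, fun n hn m x y h => ?_⟩
    have hlim : Filter.Tendsto
        (fun k => ‖∑ i, ⟪y i, (toOp (u n) - toOp (u k)) (x i)⟫_ℂ‖) Filter.atTop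
        (nhds ‖∑ i, ⟪y i, (toOp (u n) - T) (x i)⟫_ℂ‖) := by
      have hc : Continuous fun S : X →L[ℂ] X => ‖∑ i, ⟪y i, (toOp (u n) - S) (x i)⟫_ℂ‖ := by
        fun_prop
      exact (hc.tendsto T).comp hT
    refine le_of_tendsto hlim (Filter.eventually_atTop.2 ⟨N, fun k hk => ?_⟩)
    have h1 := h.norm_sum_inner_le (u n - u k).isTraceClass_toOp zero_le_one
    rw [one_mul, ← norm_eq, map_sub] at h1
    refine h1.trans ?_
    rw [← dist_eq_norm]
    exact (hN n hn k hk).le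
  obtain ⟨N, hN⟩ := key 1 one_pos
  have hTc : IsTraceClass T := by
    have h1 : IsTraceClass (toOp (u N) - T) := isTraceClass_of_forall (hN N le_rfl)
    have h2 := (traceClassSubmodule X).sub_mem (u N).isTraceClass_toOp h1
    rwa [sub_sub_cancel] at h2
  refine ⟨mk T hTc, Metric.tendsto_atTop.2 fun ε hε => ?_⟩
  obtain ⟨N, hN⟩ := key (ε / 2) (by positivity)
  refine ⟨N, fun n hn => ?_⟩
  rw [dist_eq_norm, norm_eq, map_sub, toOp_mk]
  exact (toReal_traceNorm_le_of_forall (by positivity) (hN n hn)).trans_lt (by linarith)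

/-- The trace as a continuous linear functional. -/
noncomputable def trace : TraceClass X →L[ℂ] ℂ :=
  LinearMap.mkContinuous
    { toFun := fun T => opTrace (toOp T)
      map_add' := fun S T => by
        simp only [opTrace, map_add, add_apply, inner_add_right]
        exact S.isTraceClass_toOp.summable_trace.tsum_add T.isTraceClass_toOp.summable_trace
      map_smul' := fun c T => by
        simp only [opTrace, map_smul, smul_apply, inner_smul_right, tsum_mul_left, smul_eq_mul,
          RingHom.id_apply] }
    1 fun T => by
      rw [one_mul]
      exact T.isTraceClass_toOp.norm_opTrace_le

theorem trace_apply (T : TraceClass X) : trace T = opTrace (toOp T) := rfl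

/-- `T ↦ V T W`, from trace class operators on `X` to those on `Y`. -/
noncomputable def sandwichFixed (V : X →L[ℂ] Y) (W : Y →L[ℂ] X) :
    TraceClass X →L[ℂ] TraceClass Y :=
  LinearMap.mkContinuous
    { toFun := fun T => mk (V ∘L toOp T ∘L W) (T.isTraceClass_toOp.sandwich V W)
      map_add' := fun S T => toOp_injective (by simp)
      map_smul' := fun c T => toOp_injective (by simp) } (‖V‖ * ‖W‖) fun T =>
    T.isTraceClass_toOp.traceNorm_sandwich_le V W

@[simp]
theorem toOp_sandwichFixed (V : X →L[ℂ] Y) (W : Y →L[ℂ] X) (T : TraceClass X) :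
    toOp (sandwichFixed V W T) = V ∘L toOp T ∘L W := rfl

/-- `(V, W, T) ↦ V T W`, jointly continuous. -/
noncomputable def sandwich :
    (X →L[ℂ] Y) →L[ℂ] (Y →L[ℂ] X) →L[ℂ] TraceClass X →L[ℂ] TraceClass Y :=
  LinearMap.mkContinuous₂
    (LinearMap.mk₂ ℂ sandwichFixed
      (fun V V' W => by ext T; exact toOp_injective (by simp))
      (fun c V W => by ext T; exact toOp_injective (by simp))
      (fun V W W' => by ext T; exact toOp_injective (by simp))
      (fun c V W => by ext T; exact toOp_injective (by simp))) 1 fun V W => by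
    rw [one_mul]
    exact ContinuousLinearMap.opNorm_le_bound _ (by positivity) fun T =>
      T.isTraceClass_toOp.traceNorm_sandwich_le V W

@[simp]
theorem toOp_sandwich (V : X →L[ℂ] Y) (W : Y →L[ℂ] X) (T : TraceClass X) :
    toOp (sandwich V W T) = V ∘L toOp T ∘L W := rfl

theorem trace_sandwich (V : X →L[ℂ] Y) (W : Y →L[ℂ] X) (T : TraceClass X) :
    trace (sandwich V W T) = opTrace ((W ∘L V) ∘L toOp T) :=
  T.isTraceClass_toOp.opTrace_sandwich V W

end TraceClass

end Space
end Grushin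

namespace Grushin

/-! ### The trace pairing and its symmetries. -/

namespace TraceClass

variable {X : Type*} [NormedAddCommGroup X] [InnerProductSpace ℂ X] [CompleteSpace X]
variable {Y : Type*} [NormedAddCommGroup Y] [InnerProductSpace ℂ Y] [CompleteSpace Y]

/-- The trace pairing `(V, T) ↦ tr (V T)`. -/
noncomputable def tracePairing : (X →L[ℂ] X) →L[ℂ] TraceClass X →L[ℂ] ℂ :=
  ContinuousLinearMap.compL ℂ (TraceClass X) (TraceClass X) ℂ trace ∘L
    (sandwich (X := X) (Y := X)).flip (ContinuousLinearMap.id ℂ X)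

theorem tracePairing_apply (V : X →L[ℂ] X) (T : TraceClass X) :
    tracePairing V T = opTrace (V ∘L toOp T) := rfl

theorem tracePairing_sandwich (V : X →L[ℂ] Y) (W : Y →L[ℂ] X) (Q : Y →L[ℂ] Y)
    (T : TraceClass X) : tracePairing Q (sandwich V W T) = tracePairing (W ∘L Q ∘L V) T := by
  rw [tracePairing_apply, tracePairing_apply, toOp_sandwich, ← ContinuousLinearMap.comp_assoc]
  exact trace_sandwich (Q ∘L V) W T

/-- Closedness of the form tr M⁻¹dM: with M⁻¹ in place of `M`, the derivative of this form along S,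
evaluated on T, is -tr(M⁻¹ S M⁻¹ T), which is symmetric in S and T. -/
theorem tracePairing_mul_mul_comm (M : X →L[ℂ] X) (S T : TraceClass X) :
    tracePairing (M * toOp S * M) T = tracePairing (M * toOp T * M) S := by
  rw [tracePairing_apply, tracePairing_apply]
  exact trace_sandwich M (M * toOp T) S

end TraceClass

/-! ### Invariance of the integral of tr M⁻¹dM under affine homotopies. -/

section Homotopy

open TraceClass

theorem hasDerivAt_ringInverse {R : Type*} [NormedRing R] [NormedAlgebra ℝ R] [CompleteSpace R]
    {M : ℝ → R} {M' : R} {t : ℝ} (hM : HasDerivAt M M' t) (hu : IsUnit (M t)) :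
    HasDerivAt (fun s => Ring.inverse (M s))
      (-(Ring.inverse (M t) * M' * Ring.inverse (M t))) t := by
  obtain ⟨u, hu⟩ := hu
  have h := hasFDerivAt_ringInverse (𝕜 := ℝ) u
  rw [hu] at h
  refine (h.comp_hasDerivAt t hM).congr_deriv ?_
  rw [← hu, Ring.inverse_unit]
  simp

variable {X : Type*} [NormedAddCommGroup X] [InnerProductSpace ℂ X] [CompleteSpace X]

theorem hasDerivAt_tracePairing {V : ℝ → X →L[ℂ] X} {T : ℝ → TraceClass X} {V' : X →L[ℂ] X}
    {T' : TraceClass X} {t : ℝ} (hV : HasDerivAt V V' t) (hT : HasDerivAt T T' t) :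
    HasDerivAt (fun s => tracePairing (V s) (T s))
      (tracePairing (V t) T' + tracePairing V' (T t)) t :=
  ((tracePairing (X := X)).bilinearRestrictScalars ℝ).hasDerivAt_of_bilinear
    (fun _ => hV) (fun _ => hT)

theorem continuousOn_tracePairing {Z : Type*} [TopologicalSpace Z] {s : Set Z}
    {V : Z → X →L[ℂ] X} {T : Z → TraceClass X} (hV : ContinuousOn V s) (hT : ContinuousOn T s) :
    ContinuousOn (fun z => tracePairing (V z) (T z)) s :=
  (tracePairing.continuous.comp_continuousOn hV).clm_apply hT

theorem continuousOn_ringInverse {R Z : Type*} [NormedRing R] [CompleteSpace R]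
    [TopologicalSpace Z] {s : Set Z} {M : Z → R} (hM : ContinuousOn M s)
    (hu : ∀ z ∈ s, IsUnit (M z)) : ContinuousOn (fun z => Ring.inverse (M z)) s := by
  intro z hz
  obtain ⟨u, hu⟩ := hu z hz
  have h := NormedRing.inverse_continuousAt u
  rw [hu] at h
  exact h.comp_continuousWithinAt (hM z hz)

/-- A curve with trace class derivative differs from another such curve by a curve that is
differentiable in the trace norm, as soon as the initial values differ by a trace class
operator. -/
theorem exists_hasDerivAt_sub {A B : ℝ → X →L[ℂ] X} {a b : ℝ → TraceClass X}
    (hA : ∀ θ, HasDerivAt A (toOp (a θ)) θ) (hB : ∀ θ, HasDerivAt B (toOp (b θ)) θ)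
    (ha : Continuous a) (hb : Continuous b) (h0 : IsTraceClass (B 0 - A 0)) :
    ∃ D : ℝ → TraceClass X, (∀ θ, toOp (D θ) = B θ - A θ) ∧
      ∀ θ, HasDerivAt D (b θ - a θ) θ := by
  have hba : Continuous fun t => b t - a t := hb.sub ha
  -- The primitive is taken in trace norm; it agrees with `B - A` by the fundamental theorem of
  -- calculus in operator norm.
  refine ⟨fun θ => mk _ h0 + ∫ t in (0 : ℝ)..θ, (b t - a t), fun θ => ?_, fun θ => ?_⟩
  · have hc : Continuous fun t => toOp (b t - a t) := by fun_prop
    have h1 : ∫ t in (0 : ℝ)..θ, toOp (b t - a t) = (B θ - A θ) - (B 0 - A 0) := by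
      refine intervalIntegral.integral_eq_sub_of_hasDerivAt (f := fun t => B t - A t)
        (fun t _ => ?_) (hc.intervalIntegrable _ _)
      rw [map_sub]
      exact (hB t).sub (hA t)
    have h2 := ContinuousLinearMap.intervalIntegral_comp_comm toOp (hba.intervalIntegrable
      (μ := MeasureTheory.volume) 0 θ)
    rw [map_add, toOp_mk, ← h2, h1]
    abel
  · exact (intervalIntegral.integral_hasDerivAt_right (hba.intervalIntegrable _ _)
      (hba.stronglyMeasurableAtFilter _ _) hba.continuousAt).const_add _

/-- For M = A + s(B - A), closedness says ∂ₛ tr(M⁻¹ ∂_θ M) = ∂_θ tr(M⁻¹ ∂ₛ M). As M is affine in s,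
the mixed derivative is b - a, so first derivatives of the loops suffice. Integrating over the
rectangle, the right side vanishes by periodicity and the left side is the difference of the two
integrals. -/
theorem integral_tracePairing_eq_of_segment {A B : ℝ → X →L[ℂ] X} {a b : ℝ → TraceClass X}
    {p : ℝ} (hA : ∀ θ, HasDerivAt A (toOp (a θ)) θ) (hB : ∀ θ, HasDerivAt B (toOp (b θ)) θ)
    (ha : Continuous a) (hb : Continuous b) (h0 : IsTraceClass (B 0 - A 0))
    (hAp : A p = A 0) (hBp : B p = B 0)
    (hu : ∀ s ∈ Set.Icc (0 : ℝ) 1, ∀ θ, IsUnit (A θ + s • (B θ - A θ))) :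
    ∫ θ in (0 : ℝ)..p, tracePairing (Ring.inverse (A θ)) (a θ) =
      ∫ θ in (0 : ℝ)..p, tracePairing (Ring.inverse (B θ)) (b θ) := by
  obtain ⟨D, hD, hD'⟩ := exists_hasDerivAt_sub hA hB ha hb h0
  have hAc : Continuous A := continuous_iff_continuousAt.2 fun θ => (hA θ).continuousAt
  have hBc : Continuous B := continuous_iff_continuousAt.2 fun θ => (hB θ).continuousAt
  set M : ℝ → ℝ → X →L[ℂ] X := fun s θ => A θ + s • (B θ - A θ) with hM
  set m : ℝ → ℝ → TraceClass X := fun s θ => a θ + s • (b θ - a θ) with hm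
  -- The common value of the two mixed derivatives.
  let f : ℝ → ℝ → ℂ := fun s θ => tracePairing (Ring.inverse (M s θ)) (b θ - a θ) -
    tracePairing (Ring.inverse (M s θ) * toOp (D θ) * Ring.inverse (M s θ)) (m s θ)
  have hs : ∀ s ∈ Set.Icc (0 : ℝ) 1, ∀ θ,
      HasDerivAt (fun s => tracePairing (Ring.inverse (M s θ)) (m s θ)) (f s θ) s := by
    intro s hs θ
    have h1 : HasDerivAt (fun s => M s θ) (toOp (D θ)) s := by
      rw [hD]
      simpa [hM] using ((hasDerivAt_id s).smul_const (B θ - A θ)).const_add (A θ)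
    have h2 : HasDerivAt (fun s => m s θ) (b θ - a θ) s := by
      simpa [hm] using ((hasDerivAt_id s).smul_const (b θ - a θ)).const_add (a θ)
    convert hasDerivAt_tracePairing (hasDerivAt_ringInverse h1 (hu s hs θ)) h2 using 1
    simp [f, sub_eq_add_neg]
  have hθ : ∀ s ∈ Set.Icc (0 : ℝ) 1, ∀ θ,
      HasDerivAt (fun θ => tracePairing (Ring.inverse (M s θ)) (D θ)) (f s θ) θ := by
    intro s hs θ
    have h1 : HasDerivAt (fun θ => M s θ) (toOp (m s θ)) θ := by
      refine ((hA θ).add (((hB θ).sub (hA θ)).const_smul s)).congr_deriv ?_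
      have : toOp (s • (b θ - a θ)) = s • toOp (b θ - a θ) :=
        ContinuousLinearMap.map_smul_of_tower toOp s _
      simp only [hm]
      rw [map_add, this, map_sub]
    convert hasDerivAt_tracePairing (hasDerivAt_ringInverse h1 (hu s hs θ)) (hD' θ) using 1
    simp only [f, map_neg, neg_apply, ← sub_eq_add_neg]
    rw [tracePairing_mul_mul_comm]
  have hMc : Continuous (Function.uncurry M) := by
    simp only [hM, Function.uncurry_def]
    fun_prop
  have hMi : ContinuousOn (fun q : ℝ × ℝ => Ring.inverse (M q.1 q.2))
      (Set.Icc (0 : ℝ) 1 ×ˢ Set.univ) :=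
    continuousOn_ringInverse hMc.continuousOn fun q hq => hu q.1 hq.1 q.2
  have hDc : Continuous D := continuous_iff_continuousAt.2 fun θ => (hD' θ).continuousAt
  have hfc : ContinuousOn (Function.uncurry f) (Set.Icc (0 : ℝ) 1 ×ˢ Set.univ) := by
    have h1 : Continuous fun q : ℝ × ℝ => b q.2 - a q.2 := by fun_prop
    have h2 : Continuous fun q : ℝ × ℝ => m q.1 q.2 := by simp only [hm]; fun_prop
    have h3 : Continuous fun q : ℝ × ℝ => toOp (D q.2) := by fun_prop
    exact (continuousOn_tracePairing hMi h1.continuousOn).sub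
      (continuousOn_tracePairing ((hMi.mul h3.continuousOn).mul hMi) h2.continuousOn)
  have h01 : Set.uIcc (0 : ℝ) 1 = Set.Icc 0 1 := Set.uIcc_of_le zero_le_one
  have e1 : ∀ θ, ∫ s in (0 : ℝ)..1, f s θ =
      tracePairing (Ring.inverse (B θ)) (b θ) - tracePairing (Ring.inverse (A θ)) (a θ) := by
    intro θ
    rw [intervalIntegral.integral_eq_sub_of_hasDerivAt
      (f := fun s => tracePairing (Ring.inverse (M s θ)) (m s θ))
      (fun s h => hs s (h01 ▸ h) θ)]
    · simp [hM, hm]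
    · refine ContinuousOn.intervalIntegrable ?_
      rw [h01]
      exact hfc.comp (f := fun s => (s, θ)) (by fun_prop) fun s h => ⟨h, trivial⟩
  have e2 : ∀ s ∈ Set.Icc (0 : ℝ) 1, ∫ θ in (0 : ℝ)..p, f s θ = 0 := by
    intro s h
    rw [intervalIntegral.integral_eq_sub_of_hasDerivAt
      (f := fun θ => tracePairing (Ring.inverse (M s θ)) (D θ)) (fun θ _ => hθ s h θ)]
    · have : D p = D 0 := toOp_injective (by rw [hD, hD, hAp, hBp])
      simp [hM, hAp, hBp, this]
    · exact (hfc.comp (f := fun θ => (s, θ)) (by fun_prop)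
        fun θ _ => ⟨h, trivial⟩).intervalIntegrable
  have e3 : ∫ θ in (0 : ℝ)..p, ∫ s in (0 : ℝ)..1, f s θ = 0 := by
    rw [← MeasureTheory.intervalIntegral_intervalIntegral_swap]
    · rw [intervalIntegral.integral_congr (g := fun _ => 0) fun s h => e2 s (h01 ▸ h)]
      simp
    · have : MeasureTheory.IntegrableOn (Function.uncurry f) (Set.uIcc 0 1 ×ˢ Set.uIcc 0 p) :=
        (hfc.mono (by rw [h01]; exact Set.prod_mono le_rfl (Set.subset_univ _))).integrableOn_compact
          (isCompact_uIcc.prod isCompact_uIcc)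
      exact this.mono_set (Set.prod_mono Set.uIoc_subset_uIcc Set.uIoc_subset_uIcc)
  simp only [e1] at e3
  rw [intervalIntegral.integral_sub, sub_eq_zero] at e3
  · exact e3.symm
  · exact (continuousOn_univ.1 (continuousOn_tracePairing (continuousOn_ringInverse hBc.continuousOn
      fun θ _ => by simpa using hu 1 (by simp) θ) hb.continuousOn)).intervalIntegrable _ _
  · exact (continuousOn_univ.1 (continuousOn_tracePairing (continuousOn_ringInverse hAc.continuousOn
      fun θ _ => by simpa using hu 0 (by simp) θ) ha.continuousOn)).intervalIntegrable _ _

end Homotopy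
end Grushin

namespace Grushin

/-! ### Contraction of the loop through concentric circles. -/

section Disc

open TraceClass

variable {X : Type*} [NormedAddCommGroup X] [InnerProductSpace ℂ X] [CompleteSpace X]

theorem TraceClassContinuousOn.exists_lift {Z : Type*} [TopologicalSpace Z] {G : Z → X →L[ℂ] X}
    {s : Set Z} (h : TraceClassContinuousOn G s) :
    ∃ g : Z → TraceClass X, ContinuousOn g s ∧ ∀ z ∈ s, toOp (g z) = G z := by
  classical
  let g : Z → TraceClass X := fun z => if hz : z ∈ s then mk (G z) (h.1 z hz) else 0
  have hg : ∀ z ∈ s, toOp (g z) = G z := fun z hz => by simp [g, hz]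
  refine ⟨g, fun z hz => ?_, hg⟩
  rw [ContinuousWithinAt, tendsto_iff_norm_sub_tendsto_zero]
  have h1 := (ENNReal.tendsto_toReal ENNReal.zero_ne_top).comp (h.2 z hz)
  refine h1.congr' ?_
  filter_upwards [self_mem_nhdsWithin] with w hw
  rw [norm_eq, map_sub, hg w hw, hg z hz]
  rfl

/-- Trace norm continuity for each fixed direction becomes joint continuity in point and direction,
since the derivative is a real combination of those along 1 and `Complex.I`. -/
theorem exists_fderivWithin_lift {F : ℂ → X →L[ℂ] X}
    (hdF : ∀ v : ℂ, TraceClassContinuousOn (fun z => fderivWithin ℝ F disc z v) disc) :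
    ∃ d : ℂ → ℂ → TraceClass X, ContinuousOn (Function.uncurry d) (disc ×ˢ Set.univ) ∧
      ∀ z ∈ disc, ∀ v, toOp (d z v) = fderivWithin ℝ F disc z v := by
  obtain ⟨g, hg, hgF⟩ := (hdF 1).exists_lift
  obtain ⟨k, hk, hkF⟩ := (hdF Complex.I).exists_lift
  refine ⟨fun z v => v.re • g z + v.im • k z, ?_, fun z hz v => ?_⟩
  · have hg' := hg.comp (continuousOn_fst (s := disc ×ˢ (Set.univ : Set ℂ))) fun p hp => hp.1
    have hk' := hk.comp (continuousOn_fst (s := disc ×ˢ (Set.univ : Set ℂ))) fun p hp => hp.1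
    exact ((Complex.continuous_re.comp continuous_snd).continuousOn.smul hg').add
      ((Complex.continuous_im.comp continuous_snd).continuousOn.smul hk')
  · have e1 : toOp (v.re • g z) = v.re • toOp (g z) :=
      ContinuousLinearMap.map_smul_of_tower toOp _ _
    have e2 : toOp (v.im • k z) = v.im • toOp (k z) :=
      ContinuousLinearMap.map_smul_of_tower toOp _ _
    rw [map_add, e1, e2, hgF z hz, hkF z hz, ← map_smul, ← map_smul, ← map_add]
    congr 1
    simp [Complex.re_add_im]

omit [CompleteSpace X] in
theorem hasDerivAt_comp_curve {F : ℂ → X →L[ℂ] X} (hF : ContDiffOn ℝ 1 F disc) {γ : ℝ → ℂ}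
    (hγ : ∀ t, γ t ∈ disc) {γ' : ℂ} {t : ℝ} (h : HasDerivAt γ γ' t) :
    HasDerivAt (fun s => F (γ s)) (fderivWithin ℝ F disc (γ t) γ') t := by
  have h1 := (hF.differentiableOn one_ne_zero (γ t) (hγ t)).hasFDerivWithinAt
  have h2 := h1.comp_hasDerivWithinAt t (h.hasDerivWithinAt (s := Set.univ)) fun s _ => hγ s
  exact hasDerivWithinAt_univ.1 h2

/-- By compactness the inverses are bounded by some C and F is uniformly continuous. An increment
below 1/(C+1) keeps the relative perturbation below 1, and the Neumann series applies. -/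
theorem exists_uniform_isUnit_segment {F : ℂ → X →L[ℂ] X} (hF : ContinuousOn F disc)
    (hu : ∀ z ∈ disc, IsUnit (F z)) :
    ∃ δ > 0, ∀ z ∈ disc, ∀ w ∈ disc, dist z w < δ →
      ∀ s ∈ Set.Icc (0 : ℝ) 1, IsUnit (F z + s • (F w - F z)) := by
  have hc : IsCompact disc := isCompact_closedBall 0 1
  obtain ⟨C, hC⟩ := hc.exists_bound_of_continuousOn (continuousOn_ringInverse hF hu)
  have hC0 : 0 ≤ C := (norm_nonneg _).trans (hC 0 (by simp [disc]))
  obtain ⟨δ, hδ, h⟩ := Metric.uniformContinuousOn_iff.1 (hc.uniformContinuousOn_of_continuous hF)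
    (1 / (C + 1)) (by positivity)
  refine ⟨δ, hδ, fun z hz w hw hzw s hs => ?_⟩
  have h1 := h z hz w hw hzw
  rw [dist_eq_norm, norm_sub_rev] at h1
  have h2 : F z + s • (F w - F z) =
      F z * (1 - -(Ring.inverse (F z) * (s • (F w - F z)))) := by
    rw [sub_neg_eq_add, mul_add, mul_one, ← mul_assoc, Ring.mul_inverse_cancel _ (hu z hz),
      one_mul]
  rw [h2]
  refine (hu z hz).mul (isUnit_one_sub_of_norm_lt_one ?_)
  rw [norm_neg]
  calc ‖Ring.inverse (F z) * (s • (F w - F z))‖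
      ≤ ‖Ring.inverse (F z)‖ * (‖s‖ * ‖F w - F z‖) := by
        refine (norm_mul_le _ _).trans ?_
        gcongr
        exact norm_smul_le _ _
    _ ≤ C * (1 * (1 / (C + 1))) := by
        gcongr
        · exact hC z hz
        · rw [Real.norm_of_nonneg hs.1]
          exact hs.2
    _ < 1 := by
        rw [one_mul, mul_one_div, div_lt_one (by positivity)]
        linarith

theorem isTraceClass_sub_of_mem_Icc {F : ℂ → X →L[ℂ] X} (hF : ContDiffOn ℝ 1 F disc)
    {d : ℂ → ℂ → TraceClass X} (hd : ContinuousOn (Function.uncurry d) (disc ×ˢ Set.univ))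
    (hdF : ∀ z ∈ disc, ∀ v, toOp (d z v) = fderivWithin ℝ F disc z v) {r s : ℝ}
    (hr : r ∈ Set.Icc (0 : ℝ) 1) (hs : s ∈ Set.Icc (0 : ℝ) 1) : IsTraceClass (F s - F r) := by
  -- The radius is parametrized by the cosine so that the curve stays in the disc for every real t,
  -- as `hasDerivAt_comp_curve` requires; an affine parametrization would leave it.
  have hm : ∀ t : ℝ, ((Real.cos t : ℝ) : ℂ) ∈ disc := fun t => by
    simpa [disc, -Complex.ofReal_cos] using Real.abs_cos_le_one t
  have hder : ∀ t : ℝ, HasDerivAt (fun t : ℝ => F ((Real.cos t : ℝ) : ℂ))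
      (toOp (d (Real.cos t : ℝ) (-Real.sin t : ℝ))) t := fun t => by
    rw [hdF _ (hm t)]
    exact hasDerivAt_comp_curve hF hm (Real.hasDerivAt_cos t).ofReal_comp
  have hc : Continuous fun t : ℝ => d (Real.cos t : ℝ) (-Real.sin t : ℝ) :=
    hd.comp_continuous (f := fun t : ℝ => (((Real.cos t : ℝ) : ℂ), ((-Real.sin t : ℝ) : ℂ)))
      (by fun_prop) fun t => ⟨hm t, trivial⟩
  have h1 := intervalIntegral.integral_eq_sub_of_hasDerivAt
    (a := Real.arccos r) (b := Real.arccos s) (fun t _ => hder t)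
    ((toOp.continuous.comp hc).intervalIntegrable _ _)
  have h2 := ContinuousLinearMap.intervalIntegral_comp_comm toOp
    (hc.intervalIntegrable (μ := MeasureTheory.volume) (Real.arccos r) (Real.arccos s))
  rw [h2, Real.cos_arccos (by linarith [hr.1]) hr.2, Real.cos_arccos (by linarith [hs.1]) hs.2]
    at h1
  rw [← h1]
  exact isTraceClass_toOp _

theorem integral_tracePairing_circle_eq_zero {F : ℂ → X →L[ℂ] X} (hF : ContDiffOn ℝ 1 F disc)
    (hu : ∀ z ∈ disc, IsUnit (F z))
    (hdF : ∀ v : ℂ, TraceClassContinuousOn (fun z => fderivWithin ℝ F disc z v) disc) :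
    ∃ q : ℝ → TraceClass X, Continuous q ∧
      (∀ θ, HasDerivAt (fun θ => F (Circle.exp θ)) (toOp (q θ)) θ) ∧
      ∫ θ in (0 : ℝ)..(2 * Real.pi), tracePairing (Ring.inverse (F (Circle.exp θ))) (q θ) = 0 := by
  obtain ⟨d, hd, hdF⟩ := exists_fderivWithin_lift hdF
  let γ : ℝ → ℝ → ℂ := fun r θ => r * Circle.exp θ
  let γ' : ℝ → ℝ → ℂ := fun r θ => r * (Circle.exp θ * Complex.I)
  have hγ' : ∀ r θ, HasDerivAt (γ r) (γ' r θ) θ := fun r θ => by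
    have h1 : HasDerivAt (fun t : ℝ => Complex.exp (t * Complex.I))
        (Complex.exp (θ * Complex.I) * Complex.I) θ := by
      simpa using ((hasDerivAt_id θ).ofReal_comp.mul_const Complex.I).cexp
    simpa [γ, γ', Circle.coe_exp] using h1.const_mul (r : ℂ)
  have hγ : ∀ r ∈ Set.Icc (0 : ℝ) 1, ∀ θ, γ r θ ∈ disc := fun r hr θ => by
    simpa [γ, disc, abs_of_nonneg hr.1] using hr.2
  have hγc : ∀ r, Continuous (γ r) := fun r =>
    continuous_iff_continuousAt.2 fun θ => (hγ' r θ).continuousAt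
  have hγ'c : ∀ r, Continuous (γ' r) := fun r => by
    have := Circle.exp.continuous
    simp only [γ']
    fun_prop
  have hA : ∀ r ∈ Set.Icc (0 : ℝ) 1, ∀ θ,
      HasDerivAt (fun θ => F (γ r θ)) (toOp (d (γ r θ) (γ' r θ))) θ := fun r hr θ => by
    rw [hdF _ (hγ r hr θ)]
    exact hasDerivAt_comp_curve hF (hγ r hr) (hγ' r θ)
  have ha : ∀ r ∈ Set.Icc (0 : ℝ) 1, Continuous fun θ => d (γ r θ) (γ' r θ) := fun r hr =>
    hd.comp_continuous ((hγc r).prodMk (hγ'c r)) fun θ => ⟨hγ r hr θ, trivial⟩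
  have hper : ∀ r, γ r (2 * Real.pi) = γ r 0 := fun r => by simp [γ]
  let I : Set.Icc (0 : ℝ) 1 → ℂ := fun r =>
    ∫ θ in (0 : ℝ)..(2 * Real.pi), tracePairing (Ring.inverse (F (γ r θ))) (d (γ r θ) (γ' r θ))
  obtain ⟨δ, hδ, hseg⟩ := exists_uniform_isUnit_segment hF.continuousOn hu
  -- Points of the two circles with the same angle are at distance |s - r|, so for |s - r| < δ the
  -- segments between their operators stay invertible.
  have hI : IsLocallyConstant I := by
    rw [IsLocallyConstant.iff_eventually_eq]
    intro r
    filter_upwards [Metric.ball_mem_nhds r hδ] with s hs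
    refine integral_tracePairing_eq_of_segment (hA s s.2) (hA r r.2) (ha s s.2) (ha r r.2) ?_
      (by simp only [hper]) (by simp only [hper])
      fun t ht θ => hseg _ (hγ s s.2 θ) _ (hγ r r.2 θ) ?_ t ht
    · simpa [γ] using isTraceClass_sub_of_mem_Icc hF hd hdF s.2 r.2
    · have : dist (γ s θ) (γ r θ) = dist s r := by
        simp only [γ, dist_eq_norm, ← sub_mul, norm_mul, Circle.norm_coe, mul_one,
          ← Complex.ofReal_sub, Complex.norm_real, Subtype.dist_eq]
      rwa [this]
  have h10 := hI.apply_eq_of_preconnectedSpace ⟨1, by simp⟩ ⟨0, by simp⟩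
  have h1 : (1 : ℝ) ∈ Set.Icc (0 : ℝ) 1 := by simp
  refine ⟨fun θ => d (γ 1 θ) (γ' 1 θ), ha 1 h1, ?_, ?_⟩
  · simpa [γ] using hA 1 h1
  · have hz : I ⟨0, by simp⟩ = 0 := by
      have : ∀ θ, d (γ 0 θ) (γ' 0 θ) = 0 := fun θ => toOp_injective (by
        rw [hdF _ (hγ 0 (by simp) θ)]
        simp [γ'])
      simp [I, this]
    rw [← h10.trans hz]
    simp [I, γ]

end Disc
end Grushin

namespace Grushin

/-! ### The Schur complement identity. -/

section SchurComplement

variable {X H K : Type*} [NormedAddCommGroup X] [NormedSpace ℂ X] [NormedAddCommGroup H]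
  [NormedSpace ℂ H] [NormedAddCommGroup K] [NormedSpace ℂ K]

/-- If the upper left block of an invertible operator `Q` is invertible, then so is the lower right
block of `Q⁻¹`, and `Q⁻¹` is the sum of the inverse of the former and of a term factoring through
the inverse of the latter. -/
theorem isUnit_block_inverse_and_inverse_eq {Q : X →L[ℂ] X} (hQ : IsUnit Q)
    {i : H →L[ℂ] X} {p : X →L[ℂ] H} {j : K →L[ℂ] X} {q : X →L[ℂ] K}
    (hqj : ∀ k, q (j k) = k) (hpj : ∀ k, p (j k) = 0) (hqi : ∀ h, q (i h) = 0)
    (hadd : ∀ x, i (p x) + j (q x) = x) (hP : IsUnit (p ∘L Q ∘L i)) :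
    IsUnit (q ∘L Ring.inverse Q ∘L j) ∧
      Ring.inverse Q = i ∘L Ring.inverse (p ∘L Q ∘L i) ∘L p +
        (Ring.inverse Q ∘L j) ∘L Ring.inverse (q ∘L Ring.inverse Q ∘L j) ∘L
          (q ∘L Ring.inverse Q) := by
  set R := Ring.inverse Q
  set P := p ∘L Q ∘L i
  set E := q ∘L R ∘L j
  have hQR : ∀ x, Q (R x) = x := fun x =>
    congrArg (fun T : X →L[ℂ] X => T x) (Ring.mul_inverse_cancel Q hQ)
  have hRQ : ∀ x, R (Q x) = x := fun x =>
    congrArg (fun T : X →L[ℂ] X => T x) (Ring.inverse_mul_cancel Q hQ)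
  have hPP : ∀ h, p (Q (i (Ring.inverse P h))) = h := fun h =>
    congrArg (fun T : H →L[ℂ] H => T h) (Ring.mul_inverse_cancel P hP)
  have hPP' : ∀ h, Ring.inverse P (p (Q (i h))) = h := fun h =>
    congrArg (fun T : H →L[ℂ] H => T h) (Ring.inverse_mul_cancel P hP)
  -- Since pQZ = 0 and ZQi = 0, `Z` factors through `j` and `q` on both sides: Z = R j q Q Z and Z =
  -- Z Q j q R.
  let Z : X →L[ℂ] X := R - i ∘L Ring.inverse P ∘L p
  have hZ : ∀ x, Z x = R x - i (Ring.inverse P (p x)) := fun x => rfl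
  have hZ1 : ∀ x, R (j (q (Q (Z x)))) = Z x := fun x => by
    have h1 : p (Q (Z x)) = 0 := by rw [hZ, map_sub, map_sub, hQR, hPP, sub_self]
    have h2 := hadd (Q (Z x))
    rw [h1, map_zero, zero_add] at h2
    rw [h2, hRQ]
  have hZ2 : ∀ x, Z (Q (j (q (R x)))) = Z x := fun x => by
    have h1 : ∀ h, Z (Q (i h)) = 0 := fun h => by rw [hZ, hRQ, hPP', sub_self]
    have h2 := congrArg (fun y => Z (Q y)) (hadd (R x))
    simpa only [map_add, h1, zero_add, hQR] using h2
  -- This is the Schur complement qQj - qQi P⁻¹ pQj, the inverse of `E`.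
  let S : K →L[ℂ] K := q ∘L Q ∘L Z ∘L Q ∘L j
  have hES : E * S = 1 := by
    ext k
    change q (R (j (q (Q (Z (Q (j k))))))) = k
    rw [hZ1, hZ, map_sub, hRQ, hqj, hqi, sub_zero]
  have hSE : S * E = 1 := by
    ext k
    change q (Q (Z (Q (j (q (R (j k))))))) = k
    rw [hZ2, hZ, map_sub, hQR, hpj]
    simp [hqj]
  let u : (K →L[ℂ] K)ˣ := ⟨E, S, hES, hSE⟩
  have hS : Ring.inverse E = S := Ring.inverse_unit u
  refine ⟨u.isUnit, ?_⟩
  rw [hS]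
  ext x
  change R x = i (Ring.inverse P (p x)) + R (j (q (Q (Z (Q (j (q (R x))))))))
  rw [hZ2, hZ1, hZ, add_sub_cancel]

end SchurComplement

/-! ### Loop integrals in trace norm. -/

section Loop

open TraceClass

variable {X : Type*} [NormedAddCommGroup X] [InnerProductSpace ℂ X] [CompleteSpace X]

theorem continuous_sandwich {Y Z : Type*} [NormedAddCommGroup Y] [InnerProductSpace ℂ Y]
    [CompleteSpace Y] [TopologicalSpace Z] {V : Z → X →L[ℂ] Y} {W : Z → Y →L[ℂ] X}
    {T : Z → TraceClass X} (hV : Continuous V) (hW : Continuous W) (hT : Continuous T) :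
    Continuous fun z => sandwich (V z) (W z) (T z) :=
  ((sandwich.continuous.comp hV).clm_apply hW).clm_apply hT

theorem continuous_tracePairing {Z : Type*} [TopologicalSpace Z] {V : Z → X →L[ℂ] X}
    {T : Z → TraceClass X} (hV : Continuous V) (hT : Continuous T) :
    Continuous fun z => tracePairing (V z) (T z) :=
  (tracePairing.continuous.comp hV).clm_apply hT

theorem hasDerivAt_comp_comp {E G : Type*} [NormedAddCommGroup E] [NormedSpace ℂ E]
    [NormedAddCommGroup G] [NormedSpace ℂ G] (p : E →L[ℂ] G) (i : G →L[ℂ] E)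
    {A : ℝ → E →L[ℂ] E} {A' : E →L[ℂ] E} {t : ℝ} (hA : HasDerivAt A A' t) :
    HasDerivAt (fun s => p ∘L A s ∘L i) (p ∘L A' ∘L i) t := by
  let L : (E →L[ℂ] E) →L[ℂ] G →L[ℂ] G :=
    ContinuousLinearMap.compL ℂ G E G p ∘L (ContinuousLinearMap.compL ℂ G E E).flip i
  exact (L.restrictScalars ℝ).hasFDerivAt.comp_hasDerivAt t hA

theorem isC1Loop_of_hasDerivAt {A : Circle → X →L[ℂ] X} {a : ℝ → TraceClass X}
    (ha : Continuous a) (hA : ∀ θ, HasDerivAt (fun s : ℝ => A (Circle.exp s)) (toOp (a θ)) θ) :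
    IsC1Loop A := by
  refine contDiff_one_iff_deriv.2 ⟨fun θ => (hA θ).differentiableAt, ?_⟩
  rw [funext fun θ => (hA θ).deriv]
  fun_prop

/-- The operator norm integral is the image of a trace norm integral, so it is of trace class and
the continuous functional `trace` passes under the integral sign. -/
theorem loopIntegral_eq_toOp {A B : Circle → X →L[ℂ] X} {a : ℝ → TraceClass X}
    (ha : Continuous a) (hA : ∀ θ, HasDerivAt (fun s : ℝ => A (Circle.exp s)) (toOp (a θ)) θ)
    (hB : Continuous fun θ : ℝ => B (Circle.exp θ)) :
    loopIntegral B A = toOp (∫ θ in (0 : ℝ)..(2 * Real.pi),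
      sandwich (B (Circle.exp θ)) (ContinuousLinearMap.id ℂ X) (a θ)) := by
  have hc : Continuous fun θ : ℝ =>
      sandwich (B (Circle.exp θ)) (ContinuousLinearMap.id ℂ X) (a θ) :=
    continuous_sandwich hB continuous_const ha
  rw [← ContinuousLinearMap.intervalIntegral_comp_comm toOp (hc.intervalIntegrable _ _),
    loopIntegral]
  refine intervalIntegral.integral_congr fun θ _ => ?_
  simp only [(hA θ).deriv]
  rfl

theorem isTraceClass_loopIntegral {A B : Circle → X →L[ℂ] X} {a : ℝ → TraceClass X}
    (ha : Continuous a) (hA : ∀ θ, HasDerivAt (fun s : ℝ => A (Circle.exp s)) (toOp (a θ)) θ)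
    (hB : Continuous fun θ : ℝ => B (Circle.exp θ)) : IsTraceClass (loopIntegral B A) := by
  rw [loopIntegral_eq_toOp ha hA hB]
  exact isTraceClass_toOp _

theorem opTrace_loopIntegral {A B : Circle → X →L[ℂ] X} {a : ℝ → TraceClass X}
    (ha : Continuous a) (hA : ∀ θ, HasDerivAt (fun s : ℝ => A (Circle.exp s)) (toOp (a θ)) θ)
    (hB : Continuous fun θ : ℝ => B (Circle.exp θ)) :
    opTrace (loopIntegral B A) =
      ∫ θ in (0 : ℝ)..(2 * Real.pi), tracePairing (B (Circle.exp θ)) (a θ) := by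
  have hc : Continuous fun θ : ℝ =>
      sandwich (B (Circle.exp θ)) (ContinuousLinearMap.id ℂ X) (a θ) :=
    continuous_sandwich hB continuous_const ha
  rw [loopIntegral_eq_toOp ha hA hB, ← trace_apply,
    ← ContinuousLinearMap.intervalIntegral_comp_comm trace (hc.intervalIntegrable _ _)]
  rfl

end Loop

/-! ### The trace formula for abstract blocks. -/

section BlockTrace

open TraceClass

variable {X H K : Type*} [NormedAddCommGroup X] [InnerProductSpace ℂ X] [CompleteSpace X]
  [NormedAddCommGroup H] [InnerProductSpace ℂ H] [CompleteSpace H]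
  [NormedAddCommGroup K] [InnerProductSpace ℂ K] [CompleteSpace K]

/-- The trace formula for a contractible loop of invertible operators on a space `X ≅ H ⊕ K` with
inclusions `i`, `j` and projections `p`, `q`, whose upper left blocks `P` are invertible; `E` are
the lower right blocks of the inverses. -/
theorem opTrace_loopIntegral_block_eq {i : H →L[ℂ] X} {p : X →L[ℂ] H} {j : K →L[ℂ] X}
    {q : X →L[ℂ] K} (hqj : ∀ k, q (j k) = k) (hpj : ∀ k, p (j k) = 0) (hqi : ∀ h, q (i h) = 0)
    (hadd : ∀ x, i (p x) + j (q x) = x) {F : ℂ → X →L[ℂ] X} (hF : ContDiffOn ℝ 1 F disc)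
    (hu : ∀ z ∈ disc, IsUnit (F z))
    (hdF : ∀ v : ℂ, TraceClassContinuousOn (fun z => fderivWithin ℝ F disc z v) disc)
    {P : Circle → H →L[ℂ] H} {E : Circle → K →L[ℂ] K}
    (hPF : ∀ t : Circle, P t = p ∘L F t ∘L i)
    (hEF : ∀ t : Circle, E t = q ∘L Ring.inverse (F t) ∘L j) (hP : ∀ t, IsUnit (P t)) :
    IsC1Loop P ∧ IsC1Loop E ∧ (∀ t, IsUnit (E t)) ∧
      IsTraceClass (loopIntegral (fun t => Ring.inverse (P t)) P) ∧
      opTrace (loopIntegral (fun t => Ring.inverse (P t)) P) =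
        opTrace (loopIntegral (fun t => Ring.inverse (E t)) E) := by
  obtain ⟨f, hf, hFf, hint⟩ := integral_tracePairing_circle_eq_zero hF hu hdF
  have hFu : ∀ t : Circle, IsUnit (F t) := fun t => hu _ (by simp [disc, t.norm_coe])
  have hblock : ∀ t : Circle, IsUnit (E t) ∧ Ring.inverse (F t) =
      i ∘L Ring.inverse (P t) ∘L p + (Ring.inverse (F t) ∘L j) ∘L Ring.inverse (E t) ∘L
        (q ∘L Ring.inverse (F t)) := fun t => by
    rw [hEF, hPF]
    exact isUnit_block_inverse_and_inverse_eq (hFu t) hqj hpj hqi hadd (hPF t ▸ hP t)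
  have hFc : Continuous fun θ : ℝ => F (Circle.exp θ) :=
    continuous_iff_continuousAt.2 fun θ => (hFf θ).continuousAt
  have hRc : Continuous fun θ : ℝ => Ring.inverse (F (Circle.exp θ)) :=
    continuousOn_univ.1 (continuousOn_ringInverse hFc.continuousOn fun θ _ => hFu _)
  let a : ℝ → TraceClass H := fun θ => sandwich p i (f θ)
  -- The derivative of qF⁻¹j, namely -qF⁻¹F'F⁻¹j.
  let b : ℝ → TraceClass K := fun θ =>
    -sandwich (q ∘L Ring.inverse (F (Circle.exp θ))) (Ring.inverse (F (Circle.exp θ)) ∘L j) (f θ)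
  have ha : Continuous a := continuous_sandwich continuous_const continuous_const hf
  have hb : Continuous b :=
    (continuous_sandwich (continuous_const.clm_comp hRc) (hRc.clm_comp continuous_const) hf).neg
  have hPa : ∀ θ, HasDerivAt (fun s : ℝ => P (Circle.exp s)) (toOp (a θ)) θ := fun θ => by
    simp only [hPF]
    exact hasDerivAt_comp_comp p i (hFf θ)
  have hEb : ∀ θ, HasDerivAt (fun s : ℝ => E (Circle.exp s)) (toOp (b θ)) θ := fun θ => by
    simp only [hEF]
    refine (hasDerivAt_comp_comp q j (hasDerivAt_ringInverse (hFf θ) (hFu _))).congr_deriv ?_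
    ext k
    simp [b]
  have hPc : Continuous fun θ : ℝ => Ring.inverse (P (Circle.exp θ)) :=
    continuousOn_univ.1 (continuousOn_ringInverse
      (continuous_iff_continuousAt.2 fun θ => (hPa θ).continuousAt).continuousOn fun θ _ => hP _)
  have hEc : Continuous fun θ : ℝ => Ring.inverse (E (Circle.exp θ)) :=
    continuousOn_univ.1 (continuousOn_ringInverse
      (continuous_iff_continuousAt.2 fun θ => (hEb θ).continuousAt).continuousOn
      fun θ _ => (hblock _).1)
  refine ⟨isC1Loop_of_hasDerivAt ha hPa, isC1Loop_of_hasDerivAt hb hEb, fun t => (hblock t).1,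
    isTraceClass_loopIntegral ha hPa hPc, ?_⟩
  rw [opTrace_loopIntegral ha hPa hPc, opTrace_loopIntegral hb hEb hEc, ← sub_eq_zero,
    ← intervalIntegral.integral_sub, ← hint]
  · refine intervalIntegral.integral_congr fun θ _ => ?_
    -- Cyclicity turns both terms into pairings with the same `f θ`; their operators i P⁻¹ p and
    -- F⁻¹j E⁻¹ qF⁻¹ add up to F⁻¹ by the Schur identity.
    simp only [a, b, map_neg, tracePairing_sandwich, sub_neg_eq_add]
    rw [← add_apply, ← map_add]
    congr 2
    exact (hblock _).2.symm
  · exact (continuous_tracePairing hPc ha).intervalIntegrable _ _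
  · exact (continuous_tracePairing hEc hb).intervalIntegrable _ _

end BlockTrace

/-! ### The concrete splitting of `Sum2 H N`, and the theorem. -/

section Blocks

variable {H : Type*} [NormedAddCommGroup H] [InnerProductSpace ℂ H] {N : ℕ}

/-- The inclusion of `H` into `H ⊕ ℂ^N`. -/
noncomputable def inclH (H : Type*) [NormedAddCommGroup H] [InnerProductSpace ℂ H] (N : ℕ) :
    H →L[ℂ] Sum2 H N :=
  ((WithLp.prodContinuousLinearEquiv 2 ℂ H (EuclideanSpace ℂ (Fin N))).symm :
      H × EuclideanSpace ℂ (Fin N) →L[ℂ] Sum2 H N) ∘L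
    ContinuousLinearMap.inl ℂ H (EuclideanSpace ℂ (Fin N))

/-- The projection of `H ⊕ ℂ^N` to `H`. -/
noncomputable def projH (H : Type*) [NormedAddCommGroup H] [InnerProductSpace ℂ H] (N : ℕ) :
    Sum2 H N →L[ℂ] H :=
  ContinuousLinearMap.fst ℂ H (EuclideanSpace ℂ (Fin N)) ∘L
    ((WithLp.prodContinuousLinearEquiv 2 ℂ H (EuclideanSpace ℂ (Fin N))) :
      Sum2 H N →L[ℂ] H × EuclideanSpace ℂ (Fin N))

/-- The inclusion of `ℂ^N` into `H ⊕ ℂ^N`. -/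
noncomputable def inclFin (H : Type*) [NormedAddCommGroup H] [InnerProductSpace ℂ H] (N : ℕ) :
    EuclideanSpace ℂ (Fin N) →L[ℂ] Sum2 H N :=
  ((WithLp.prodContinuousLinearEquiv 2 ℂ H (EuclideanSpace ℂ (Fin N))).symm :
      H × EuclideanSpace ℂ (Fin N) →L[ℂ] Sum2 H N) ∘L
    ContinuousLinearMap.inr ℂ H (EuclideanSpace ℂ (Fin N))

/-- The projection of `H ⊕ ℂ^N` to `ℂ^N`. -/
noncomputable def projFin (H : Type*) [NormedAddCommGroup H] [InnerProductSpace ℂ H] (N : ℕ) :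
    Sum2 H N →L[ℂ] EuclideanSpace ℂ (Fin N) :=
  ContinuousLinearMap.snd ℂ H (EuclideanSpace ℂ (Fin N)) ∘L
    ((WithLp.prodContinuousLinearEquiv 2 ℂ H (EuclideanSpace ℂ (Fin N))) :
      Sum2 H N →L[ℂ] H × EuclideanSpace ℂ (Fin N))

theorem effHam_eq (Q : Sum2 H N →L[ℂ] Sum2 H N) :
    effHam Q = projFin H N ∘L Ring.inverse Q ∘L inclFin H N := rfl

theorem projH_grushin_inclH (P : H →L[ℂ] H) (Rm : EuclideanSpace ℂ (Fin N) →L[ℂ] H)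
    (Rp : H →L[ℂ] EuclideanSpace ℂ (Fin N)) :
    projH H N ∘L grushin P Rm Rp ∘L inclH H N = P := by
  ext h
  simp [projH, grushin, inclH]

end Blocks

end Grushin

theorem proposition4p2 {H : Type*} [NormedAddCommGroup H] [InnerProductSpace ℂ H]
    [CompleteSpace H] (N : ℕ)
    (P : Circle → H →L[ℂ] H)
    (Rm : Circle → EuclideanSpace ℂ (Fin N) →L[ℂ] H)
    (Rp : Circle → H →L[ℂ] EuclideanSpace ℂ (Fin N))
    (F : ℂ → Grushin.Sum2 H N →L[ℂ] Grushin.Sum2 H N)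
    (hF : Grushin.IsContraction {Q | IsUnit Q}
      (fun t => Grushin.grushin (P t) (Rm t) (Rp t)) F)
    (hdF : ∀ v : ℂ, Grushin.TraceClassContinuousOn
      (fun z => fderivWithin ℝ F Grushin.disc z v) Grushin.disc)
    (Emp : Circle → EuclideanSpace ℂ (Fin N) →L[ℂ] EuclideanSpace ℂ (Fin N))
    (hEmp : ∀ t, Emp t = Grushin.effHam (Grushin.grushin (P t) (Rm t) (Rp t)))
    (hP : ∀ t, IsUnit (P t)) :
    Grushin.IsC1Loop P ∧
    Grushin.IsC1Loop Emp ∧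
    (∀ t, IsUnit (Emp t)) ∧
    Grushin.IsTraceClass (Grushin.loopIntegral (fun t => Ring.inverse (P t)) P) ∧
    Grushin.opTrace (Grushin.loopIntegral (fun t => Ring.inverse (P t)) P) =
      Grushin.opTrace (Grushin.loopIntegral (fun t => Ring.inverse (Emp t)) Emp) := by
  refine Grushin.opTrace_loopIntegral_block_eq (i := Grushin.inclH H N) (p := Grushin.projH H N)
    (j := Grushin.inclFin H N) (q := Grushin.projFin H N)
    (fun k => by simp [Grushin.projFin, Grushin.inclFin])
    (fun k => by simp [Grushin.projH, Grushin.inclFin])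
    (fun k => by simp [Grushin.projFin, Grushin.inclH]) (fun x => ?_)
    hF.contDiffOn hF.mapsTo hdF (fun t => ?_) (fun t => ?_) hP
  · refine (WithLp.prodContinuousLinearEquiv 2 ℂ H (EuclideanSpace ℂ (Fin N))).injective ?_
    simp [Grushin.projH, Grushin.inclH, Grushin.projFin, Grushin.inclFin]
    rfl
  · rw [hF.boundary, Grushin.projH_grushin_inclH]
  · rw [hEmp, hF.boundary, Grushin.effHam_eq]
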